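/- Let $\mathbb D$ be the open unit disc, $\mathbb T$ the unit circle, and let $\mathcal D$ be a separable complex Hilbert space. Write $H^2(\mathcal D)$ for the Hardy space of power series with square summable coefficients in $\mathcal D$, and $H^2=H^2(\mathbb C)$. Let $B\in\mathcal S(\mathcal D,\mathbb C)$, i.e. $B$ is an analytic function on $\mathbb D$ whose values are contractive linear operators $\mathcal D\to\mathbb C$, and let $T_B:H^2(\mathcal D)\to H^2$, $(T_Bf)(z)=B(z)f(z)$. The de Branges–Rovnyak space $\mathcal H(B)\subseteq H^2$ is the range of $(I-T_BT_B^*)^{1/2}$, with the Hilbert space structure that makes $(I-T_BT_B^*)^{1/2}:H^2\to\mathcal H(B)$ a coisometry. Suppose that $\mathcal H(B)$ is $M_z$-invariant (that is, $zf\in\mathcal H(B)$ for every $f\in\mathcal H(B)$; then $M_z:f\mapsto zf$ is a bounded operator on $\mathcal H(B)$), and that the polynomials are contained in $\mathcal H(B)$ and are dense in it. Let $\lambda\in\mathbb T$. Then the following are equivalent. (i) The densely defined functional $e_\lambda(p)=p(\lambda)$, $p$ a polynomial, extends to a bounded linear functional $\mathcal H(B)\to\mathbb C$. (ii) $\overline\lambda$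 is an eigenvalue of the adjoint $M_z^*$ of $M_z$ on $\mathcal H(B)$. (iii) $[z-\lambda]\neq\mathcal H(B)$, where $[z-\lambda]$ is the closure in $\mathcal H(B)$ of the set of polynomial multiples $(z-\lambda)p$ of $z-\lambda$. (iv) Every $f\in\mathcal H(B)$ has a (finite) non-tangential limit at $\lambda$: there is $l\in\mathbb C$ such that, for every $\alpha>1$, $f(z)\to l$ as $z\to\lambda$ within $\Gamma_\alpha(\lambda)=\{z\in\mathbb D:|z-\lambda|<\alpha(1-|z|)\}$. -/

import Mathlib

open scoped ComplexConjugate Topology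

noncomputable section
namespace DeBrangesRovnyak
/-- The open unit disc. -/
abbrev unitDisc : Set ℂ := Metric.ball (0 : ℂ) 1
/-- The Hardy space `H²(E)` of power series with square summable coefficients in `E`. -/
abbrev H2 (E : Type*) [NormedAddCommGroup E] : Type _ := lp (fun _ : ℕ => E) 2

/-- The value `∑ aₙ zⁿ` (for `z` in the unit disc) of the element `(aₙ)` of `H²(E)`. -/
def H2.eval {E : Type*} [NormedAddCommGroup E] [InnerProductSpace ℂ E]
    (f : H2 E) (z : ℂ) : E := ∑' n, z ^ n • f n

theorem integral_exp_mul_conj (m n : ℕ) :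
    ∫ t in (0 : ℝ)..(2 * Real.pi),
      conj (Complex.exp (t * Complex.I) ^ m) * Complex.exp (t * Complex.I) ^ n =
      if m = n then ((2 * Real.pi : ℝ) : ℂ) else 0 := by
  have key : ∀ t : ℝ, conj (Complex.exp (t * Complex.I) ^ m) * Complex.exp (t * Complex.I) ^ n
      = Complex.exp ((((n : ℂ) - m) * Complex.I) * t) := by
    intro t
    rw [map_pow, ← Complex.exp_conj, ← Complex.exp_nat_mul, ← Complex.exp_nat_mul,
      ← Complex.exp_add]
    congr 1
    simp
    ring
  simp_rw [key]
  split_ifs with h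
  · subst h
    simp
  · have hc : ((n : ℂ) - m) * Complex.I ≠ 0 := by
      refine mul_ne_zero (sub_ne_zero.2 ?_) Complex.I_ne_zero
      exact_mod_cast Ne.symm h
    rw [integral_exp_mul_complex hc]
    have : Complex.exp (((n : ℂ) - m) * Complex.I * ((2 * Real.pi : ℝ) : ℂ)) = 1 := by
      rw [Complex.exp_eq_one_iff]
      exact ⟨(n : ℤ) - m, by push_cast; ring⟩
    rw [this]
    simp

theorem norm_exp_pow_smul {E : Type*} [NormedAddCommGroup E] [InnerProductSpace ℂ E]
    (t : ℝ) (n : ℕ) (v : E) : ‖Complex.exp (t * Complex.I) ^ n • v‖ = ‖v‖ := by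
  rw [norm_smul, norm_pow, Complex.norm_exp_ofReal_mul_I, one_pow, one_mul]

/-- Parseval's identity for an absolutely convergent trigonometric series. -/
theorem parseval {E : Type*} [NormedAddCommGroup E] [InnerProductSpace ℂ E] [CompleteSpace E]
    {u : ℕ → E} (hu : Summable fun n => ‖u n‖) :
    HasSum (fun n => 2 * Real.pi * ‖u n‖ ^ 2)
      (∫ t in (0 : ℝ)..(2 * Real.pi), ‖∑' n, Complex.exp (t * Complex.I) ^ n • u n‖ ^ 2) := by
  set F : ℝ → E := fun t => ∑' n, Complex.exp (t * Complex.I) ^ n • u n with hF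
  have hsum : ∀ t : ℝ, HasSum (fun n => Complex.exp (t * Complex.I) ^ n • u n) (F t) := by
    intro t
    refine Summable.hasSum (Summable.of_norm ?_)
    simpa only [norm_exp_pow_smul] using hu
  have hcont : Continuous F := by
    refine continuous_tsum (fun n => by fun_prop) hu fun n t => ?_
    rw [norm_exp_pow_smul]
  have hFb : ∀ t, ‖F t‖ ≤ ∑' n, ‖u n‖ := by
    intro t
    refine (norm_tsum_le_tsum_norm ?_).trans_eq ?_
    · simpa only [norm_exp_pow_smul] using hu
    · simp only [norm_exp_pow_smul]
  have stepA : ∀ (k : ℕ) (v : E),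
      ∫ t in (0 : ℝ)..(2 * Real.pi), inner ℂ (Complex.exp (t * Complex.I) ^ k • v) (F t) =
        ((2 * Real.pi : ℝ) : ℂ) * inner ℂ v (u k) := by
    intro k v
    have h := intervalIntegral.hasSum_integral_of_dominated_convergence
      (μ := MeasureTheory.volume) (a := 0) (b := 2 * Real.pi)
      (F := fun n (t : ℝ) => inner ℂ (Complex.exp (t * Complex.I) ^ k • v)
        (Complex.exp (t * Complex.I) ^ n • u n))
      (f := fun t => inner ℂ (Complex.exp (t * Complex.I) ^ k • v) (F t))
      (fun n _ => ‖v‖ * ‖u n‖)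
      (fun n => (Continuous.aestronglyMeasurable (by fun_prop)))
      (fun n => Filter.Eventually.of_forall fun t _ => by
        refine (norm_inner_le_norm _ _).trans_eq ?_
        rw [norm_exp_pow_smul, norm_exp_pow_smul])
      (Filter.Eventually.of_forall fun t _ => hu.mul_left _)
      (by simp)
      (Filter.Eventually.of_forall fun t _ => (hsum t).mapL (innerSL ℂ _))
    have h2 : ∀ n, ∫ t in (0 : ℝ)..(2 * Real.pi),
        inner ℂ (Complex.exp (t * Complex.I) ^ k • v) (Complex.exp (t * Complex.I) ^ n • u n)
        = if n = k then ((2 * Real.pi : ℝ) : ℂ) * inner ℂ v (u k) else 0 := by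
      intro n
      have : ∀ t : ℝ, inner ℂ (Complex.exp (t * Complex.I) ^ k • v)
          (Complex.exp (t * Complex.I) ^ n • u n) =
          (conj (Complex.exp (t * Complex.I) ^ k) * Complex.exp (t * Complex.I) ^ n) *
            inner ℂ v (u n) := by
        intro t
        rw [inner_smul_left, inner_smul_right]
        ring
      simp_rw [this]
      rw [intervalIntegral.integral_mul_const, integral_exp_mul_conj]
      by_cases hk : k = n
      · subst hk; simp
      · simp [hk, Ne.symm hk]
    simp_rw [h2] at h
    exact h.unique (hasSum_ite_eq k _)
  have stepB := intervalIntegral.hasSum_integral_of_dominated_convergence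
      (μ := MeasureTheory.volume) (a := 0) (b := 2 * Real.pi)
      (F := fun n (t : ℝ) => inner ℂ (F t) (Complex.exp (t * Complex.I) ^ n • u n))
      (f := fun t => inner ℂ (F t) (F t))
      (fun n _ => (∑' n, ‖u n‖) * ‖u n‖)
      (fun n => (Continuous.aestronglyMeasurable (by fun_prop)))
      (fun n => Filter.Eventually.of_forall fun t _ => by
        refine (norm_inner_le_norm _ _).trans ?_
        rw [norm_exp_pow_smul]
        exact mul_le_mul_of_nonneg_right (hFb t) (norm_nonneg _))
      (Filter.Eventually.of_forall fun t _ => hu.mul_left _)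
      (by simp)
      (Filter.Eventually.of_forall fun t _ => (hsum t).mapL (innerSL ℂ (F t)))
  have h3 : ∀ n, ∫ t in (0 : ℝ)..(2 * Real.pi),
      inner ℂ (F t) (Complex.exp (t * Complex.I) ^ n • u n) =
      ((2 * Real.pi * ‖u n‖ ^ 2 : ℝ) : ℂ) := by
    intro n
    have h4 := stepA n (u n)
    have h5 := congrArg conj h4
    rw [intervalIntegral.integral_of_le (by positivity), ← integral_conj,
      ← intervalIntegral.integral_of_le (by positivity)] at h5
    simp_rw [inner_conj_symm] at h5
    rw [h5, map_mul, inner_conj_symm, Complex.conj_ofReal, inner_self_eq_norm_sq_to_K]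
    push_cast
    rfl
  simp_rw [h3] at stepB
  have h6 : ∀ t, inner ℂ (F t) (F t) = ((‖F t‖ ^ 2 : ℝ) : ℂ) := by
    intro t
    rw [inner_self_eq_norm_sq_to_K]
    push_cast
    rfl
  simp_rw [h6] at stepB
  rw [intervalIntegral.integral_ofReal] at stepB
  exact_mod_cast Complex.hasSum_ofReal.1 stepB


theorem H2.norm_apply_le {E : Type*} [NormedAddCommGroup E] (f : H2 E) (n : ℕ) : ‖f n‖ ≤ ‖f‖ :=
  lp.norm_apply_le_norm (by norm_num) f n

theorem H2.hasSum_norm_sq {E : Type*} [NormedAddCommGroup E] (f : H2 E) : HasSum (fun n => ‖f n‖ ^ 2) (‖f‖ ^ 2) := by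
  have := lp.hasSum_norm (p := 2) (by norm_num) f
  simpa using this

theorem H2.norm_le_of {E : Type*} [NormedAddCommGroup E] {f : ℕ → E} {C : ℝ} (hC : 0 ≤ C)
    (h : ∀ s : Finset ℕ, ∑ n ∈ s, ‖f n‖ ^ 2 ≤ C ^ 2) :
    ∃ hf : Memℓp f 2, ‖(⟨f, hf⟩ : H2 E)‖ ≤ C := by
  have hf : Memℓp f 2 := by
    refine memℓp_gen ?_
    simpa using summable_of_sum_le (fun n => sq_nonneg ‖f n‖) h
  refine ⟨hf, lp.norm_le_of_forall_sum_le (by norm_num) hC fun s => ?_⟩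
  simpa using h s

variable {D E : Type*} [NormedAddCommGroup D] [InnerProductSpace ℂ D]
  [NormedAddCommGroup E] [InnerProductSpace ℂ E]

theorem summable_norm_pow_smul {u : ℕ → E} {M : ℝ} (hu : ∀ n, ‖u n‖ ≤ M) {z : ℂ} (hz : ‖z‖ < 1) :
    Summable fun n => ‖z ^ n • u n‖ := by
  refine Summable.of_nonneg_of_le (fun _ => norm_nonneg _) (fun n => ?_)
    ((summable_geometric_of_lt_one (norm_nonneg z) hz).mul_right M)
  rw [norm_smul, norm_pow]
  exact mul_le_mul_of_nonneg_left (hu n) (by positivity)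

theorem H2.hasSum_eval [CompleteSpace E] (f : H2 E) {z : ℂ} (hz : z ∈ unitDisc) :
    HasSum (fun n => z ^ n • f n) (f.eval z) :=
  (summable_norm_pow_smul f.norm_apply_le (by simpa using hz)).of_norm.hasSum


theorem H2.differentiableOn_eval [CompleteSpace E] (f : H2 E) :
    DifferentiableOn ℂ f.eval unitDisc := by
  intro z hz
  have hz1 : ‖z‖ < 1 := by simpa using hz
  obtain ⟨r, hzr, hr1⟩ := exists_between hz1
  have hr0 : 0 ≤ r := (norm_nonneg z).trans hzr.le
  have h : DifferentiableOn ℂ f.eval (Metric.ball 0 r) := by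
    refine Complex.differentiableOn_tsum_of_summable_norm
      (u := fun n => r ^ n * ‖f‖) ?_ (fun n => ?_) Metric.isOpen_ball fun n w hw => ?_
    · exact (summable_geometric_of_lt_one hr0 hr1).mul_right _
    · fun_prop
    · rw [norm_smul, norm_pow]
      have hw' : ‖w‖ ≤ r := by simpa using (Metric.mem_ball.1 hw).le
      exact mul_le_mul (pow_le_pow_left₀ (norm_nonneg _) hw' n) (f.norm_apply_le n)
        (norm_nonneg _) (pow_nonneg hr0 n)
  exact (h.differentiableAt (Metric.isOpen_ball.mem_nhds (by simpa using hzr))).differentiableWithinAt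

theorem H2.eval_add [CompleteSpace E] (f g : H2 E) {z : ℂ} (hz : z ∈ unitDisc) :
    (f + g).eval z = f.eval z + g.eval z := by
  refine (H2.hasSum_eval (f + g) hz).unique ?_
  simpa only [lp.coeFn_add, Pi.add_apply, smul_add] using
    (f.hasSum_eval hz).add (g.hasSum_eval hz)

theorem H2.eval_smul [CompleteSpace E] (c : ℂ) (f : H2 E) {z : ℂ} (hz : z ∈ unitDisc) :
    (c • f).eval z = c • f.eval z := by
  refine (H2.hasSum_eval (c • f) hz).unique ?_
  simpa only [lp.coeFn_smul, Pi.smul_apply, smul_comm c] using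
    (f.hasSum_eval hz).const_smul c

/-- Evaluation at a point of the disc is bounded on `H²(E)`. -/
theorem H2.norm_eval_le [CompleteSpace E] (f : H2 E) {z : ℂ} (hz : z ∈ unitDisc) :
    ‖f.eval z‖ ≤ (1 - ‖z‖)⁻¹ * ‖f‖ := by
  have hz1 : ‖z‖ < 1 := by simpa using hz
  refine tsum_of_norm_bounded ((hasSum_geometric_of_lt_one (norm_nonneg z) hz1).mul_right ‖f‖)
    fun n => ?_
  rw [norm_smul, norm_pow]
  exact mul_le_mul_of_nonneg_left (f.norm_apply_le n) (by positivity)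

/-- The Schur class `S(D, E)`: analytic functions on the unit disc whose values are contractive
operators from `D` to `E`. -/
structure SchurClass (D E : Type*) [NormedAddCommGroup D] [InnerProductSpace ℂ D]
    [NormedAddCommGroup E] [InnerProductSpace ℂ E] where
  /-- the underlying function (only its values on the unit disc matter) -/
  toFun : ℂ → D →L[ℂ] E
  differentiableOn : DifferentiableOn ℂ toFun unitDisc
  norm_le_one : ∀ z ∈ unitDisc, ‖toFun z‖ ≤ 1

/-- The `n`-th Taylor coefficient at `0` of the function `z ↦ B(z) f(z)`. -/
def SchurClass.mulCoeff (B : SchurClass D E) (f : H2 D) (n : ℕ) : E :=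
  (n.factorial : ℂ)⁻¹ • iteratedDeriv n (fun z => B.toFun z (f.eval z)) 0

theorem SchurClass.differentiableOn_mul [CompleteSpace D] (B : SchurClass D E) (f : H2 D) :
    DifferentiableOn ℂ (fun z => B.toFun z (f.eval z)) unitDisc :=
  B.differentiableOn.clm_apply f.differentiableOn_eval

theorem SchurClass.hasSum_mulCoeff [CompleteSpace D] [CompleteSpace E] (B : SchurClass D E)
    (f : H2 D) {z : ℂ} (hz : z ∈ unitDisc) :
    HasSum (fun n => z ^ n • B.mulCoeff f n) (B.toFun z (f.eval z)) := by
  have h := Complex.hasSum_taylorSeries_on_ball (B.differentiableOn_mul f) hz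
  simpa only [sub_zero, SchurClass.mulCoeff, smul_comm (z ^ _)] using h

/-- Parseval's identity on the circle of radius `r < 1`. -/
theorem parseval_circle [CompleteSpace E] {g : ℂ → E} {c : ℕ → E}
    (hg : ∀ z ∈ unitDisc, HasSum (fun n => z ^ n • c n) (g z)) {r : ℝ} (hr0 : 0 ≤ r) (hr1 : r < 1) :
    HasSum (fun n => 2 * Real.pi * (r ^ n * ‖c n‖) ^ 2)
      (∫ t in (0 : ℝ)..(2 * Real.pi), ‖g (r * Complex.exp (t * Complex.I))‖ ^ 2) := by
  obtain ⟨ρ, hrρ, hρ1⟩ := exists_between hr1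
  have hρ0 : 0 < ρ := hr0.trans_lt hrρ
  have hs := (hg ρ (by simpa [abs_of_pos hρ0] using hρ1)).summable.tendsto_atTop_zero.norm
  obtain ⟨M, hM⟩ := hs.bddAbove_range
  have hM' : ∀ n, ‖(ρ : ℂ) ^ n • c n‖ ≤ M := fun n => hM ⟨n, rfl⟩
  have hq : ‖((r / ρ : ℝ) : ℂ)‖ < 1 := by
    rw [Complex.norm_real, Real.norm_of_nonneg (by positivity)]
    exact (div_lt_one hρ0).2 hrρ
  have hsum := summable_norm_pow_smul hM' hq
  have heq : ∀ n, ((r / ρ : ℝ) : ℂ) ^ n • (ρ : ℂ) ^ n • c n = (r : ℂ) ^ n • c n := by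
    intro n
    rw [smul_smul, ← mul_pow, ← Complex.ofReal_mul, div_mul_cancel₀ _ hρ0.ne']
  simp_rw [heq] at hsum
  have h := parseval hsum
  have hn : ∀ n, ‖(r : ℂ) ^ n • c n‖ = r ^ n * ‖c n‖ := by
    intro n
    rw [norm_smul, norm_pow, Complex.norm_real, Real.norm_of_nonneg hr0]
  have hv : ∀ t : ℝ, ∑' n, Complex.exp (t * Complex.I) ^ n • (r : ℂ) ^ n • c n =
      g (r * Complex.exp (t * Complex.I)) := by
    intro t
    have hm : (r : ℂ) * Complex.exp (t * Complex.I) ∈ unitDisc := by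
      simpa [Complex.norm_exp_ofReal_mul_I, abs_of_nonneg hr0] using hr1
    rw [← (hg _ hm).tsum_eq]
    refine tsum_congr fun n => ?_
    rw [smul_smul, mul_pow, mul_comm]
  simp_rw [hn, hv] at h
  exact h

theorem SchurClass.sum_mulCoeff_le [CompleteSpace D] [CompleteSpace E] (B : SchurClass D E)
    (f : H2 D) (s : Finset ℕ) : ∑ n ∈ s, ‖B.mulCoeff f n‖ ^ 2 ≤ ‖f‖ ^ 2 := by
  have hpi : 0 < 2 * Real.pi := by positivity
  have key : ∀ r : ℝ, 0 ≤ r → r < 1 → ∑ n ∈ s, (r ^ n * ‖B.mulCoeff f n‖) ^ 2 ≤ ‖f‖ ^ 2 := by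
    intro r hr0 hr1
    have hm : ∀ t : ℝ, (r : ℂ) * Complex.exp (t * Complex.I) ∈ unitDisc := by
      intro t
      simpa [Complex.norm_exp_ofReal_mul_I, abs_of_nonneg hr0] using hr1
    have hc : Continuous fun t : ℝ => (r : ℂ) * Complex.exp (t * Complex.I) := by fun_prop
    have h1 := parseval_circle (fun z hz => B.hasSum_mulCoeff f hz) hr0 hr1
    have h2 := parseval_circle (fun z hz => f.hasSum_eval hz) hr0 hr1
    have hint : (∫ t in (0 : ℝ)..(2 * Real.pi),
        ‖B.toFun (r * Complex.exp (t * Complex.I)) (f.eval (r * Complex.exp (t * Complex.I)))‖ ^ 2) ≤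
        ∫ t in (0 : ℝ)..(2 * Real.pi), ‖f.eval (r * Complex.exp (t * Complex.I))‖ ^ 2 := by
      refine intervalIntegral.integral_mono_on hpi.le ?_ ?_ fun t _ => ?_
      · exact ((((B.differentiableOn_mul f).continuousOn.comp_continuous hc hm).norm).pow
          2).intervalIntegrable _ _
      · exact (((f.differentiableOn_eval.continuousOn.comp_continuous hc hm).norm).pow
          2).intervalIntegrable _ _
      · refine pow_le_pow_left₀ (norm_nonneg _) ?_ 2
        simpa using (B.toFun _).le_of_opNorm_le (B.norm_le_one _ (hm t)) (f.eval _)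
    have h3 := sum_le_hasSum s (fun n _ => by positivity) h1
    have h4 := hasSum_le (fun n => ?_) h2 (f.hasSum_norm_sq.mul_left (2 * Real.pi))
    · rw [← Finset.mul_sum] at h3
      exact le_of_mul_le_mul_left ((h3.trans hint).trans h4) hpi
    · refine mul_le_mul_of_nonneg_left (pow_le_pow_left₀ (by positivity) ?_ 2) hpi.le
      exact mul_le_of_le_one_left (norm_nonneg _) (pow_le_one₀ hr0 hr1.le)
  have hlim : Filter.Tendsto (fun r : ℝ => ∑ n ∈ s, (r ^ n * ‖B.mulCoeff f n‖) ^ 2) (𝓝[<] 1)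
      (𝓝 (∑ n ∈ s, ((1 : ℝ) ^ n * ‖B.mulCoeff f n‖) ^ 2)) :=
    (Continuous.tendsto (by fun_prop) (1 : ℝ)).mono_left nhdsWithin_le_nhds
  simp only [one_pow, one_mul] at hlim
  refine le_of_tendsto hlim ?_
  filter_upwards [Ioo_mem_nhdsLT (zero_lt_one (α := ℝ))] with r hr
  exact key r hr.1.le hr.2

theorem SchurClass.memℓp_mulCoeff [CompleteSpace D] [CompleteSpace E] (B : SchurClass D E)
    (f : H2 D) : Memℓp (B.mulCoeff f) 2 :=
  (H2.norm_le_of (norm_nonneg f) (B.sum_mulCoeff_le f)).1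

/-- An element of `H²(E)` is determined by its values on the unit disc. -/
theorem H2.ext_eval [CompleteSpace E] {f g : H2 E} (h : ∀ z ∈ unitDisc, f.eval z = g.eval z) :
    f = g := by
  have h0 : ∀ z ∈ unitDisc, HasSum (fun n => z ^ n • (f n - g n)) ((fun _ => (0 : E)) z) := by
    intro z hz
    have := (f.hasSum_eval hz).sub (g.hasSum_eval hz)
    rw [h z hz, sub_self] at this
    simpa only [smul_sub] using this
  have h1 := parseval_circle h0 (r := 1 / 2) (by norm_num) (by norm_num)
  simp only [norm_zero, ne_eq, OfNat.ofNat_ne_zero, not_false_eq_true, zero_pow,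
    intervalIntegral.integral_zero] at h1
  have h2 := (hasSum_zero_iff_of_nonneg (fun n => by positivity)).1 h1
  ext n
  have h3 := congrFun h2 n
  simpa [Real.pi_ne_zero, sub_eq_zero] using h3

/-- The multiplication operator `T_B : H²(D) → H²(E)`, `(T_B f)(z) = B(z) f(z)`. -/
def SchurClass.mulOp [CompleteSpace D] [CompleteSpace E] (B : SchurClass D E) :
    H2 D →L[ℂ] H2 E :=
  LinearMap.mkContinuous
    { toFun := fun f => ⟨B.mulCoeff f, B.memℓp_mulCoeff f⟩
      map_add' := fun f g => H2.ext_eval fun z hz => by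
        rw [H2.eval_add _ _ hz]
        refine (B.hasSum_mulCoeff (f + g) hz).tsum_eq.trans ?_
        rw [H2.eval_add f g hz, map_add]
        exact congrArg₂ (· + ·) (B.hasSum_mulCoeff f hz).tsum_eq.symm
          (B.hasSum_mulCoeff g hz).tsum_eq.symm
      map_smul' := fun c f => H2.ext_eval fun z hz => by
        rw [H2.eval_smul _ _ hz]
        refine (B.hasSum_mulCoeff (c • f) hz).tsum_eq.trans ?_
        rw [H2.eval_smul c f hz, map_smul]
        exact congrArg (c • ·) (B.hasSum_mulCoeff f hz).tsum_eq.symm }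
    1 fun f => by
      rw [one_mul]
      exact (H2.norm_le_of (norm_nonneg f) (B.sum_mulCoeff_le f)).2

theorem SchurClass.eval_mulOp [CompleteSpace D] [CompleteSpace E] (B : SchurClass D E)
    (f : H2 D) {z : ℂ} (hz : z ∈ unitDisc) : (B.mulOp f).eval z = B.toFun z (f.eval z) := 
  (B.hasSum_mulCoeff f hz).tsum_eq

/-! ### Operator ranges and de Branges-Rovnyak spaces -/

section OperatorRange

variable {H K : Type*} [NormedAddCommGroup H] [InnerProductSpace ℂ H] [CompleteSpace H]
  [NormedAddCommGroup K] [InnerProductSpace ℂ K]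

/-- The operator range `M(A)`: the vector space `A(H)`, with the Hilbert space structure for which
`A : H → M(A)` is a coisometry. -/
def OperatorRange (A : H →L[ℂ] K) : Type _ := LinearMap.range (A : H →ₗ[ℂ] K)

namespace OperatorRange

variable (A : H →L[ℂ] K)

instance : AddCommGroup (OperatorRange A) :=
  inferInstanceAs (AddCommGroup (LinearMap.range (A : H →ₗ[ℂ] K)))

instance : Module ℂ (OperatorRange A) :=
  inferInstanceAs (Module ℂ (LinearMap.range (A : H →ₗ[ℂ] K)))

/-- The inclusion of `M(A)` in `K`. -/
def incl : OperatorRange A →ₗ[ℂ] K := (LinearMap.range (A : H →ₗ[ℂ] K)).subtype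

/-- The operator `A`, as a bijection from `(ker A)ᗮ` onto `M(A)`. -/
def equiv : (LinearMap.ker (A : H →ₗ[ℂ] K))ᗮ ≃ₗ[ℂ] OperatorRange A :=
  LinearEquiv.ofBijective
    ((A : H →ₗ[ℂ] K).rangeRestrict.comp (LinearMap.ker (A : H →ₗ[ℂ] K))ᗮ.subtype)
    (by
      have hc : IsClosed ((LinearMap.ker (A : H →ₗ[ℂ] K) : Submodule ℂ H) : Set H) :=
        A.isClosed_ker
      have : CompleteSpace (LinearMap.ker (A : H →ₗ[ℂ] K)) := hc.completeSpace_coe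
      constructor
      · rw [injective_iff_map_eq_zero]
        intro x hx
        have h1 : (x : H) ∈ LinearMap.ker (A : H →ₗ[ℂ] K) := congrArg Subtype.val hx
        have h2 := (Submodule.mem_orthogonal _ _).1 x.2 _ h1
        exact Subtype.ext (inner_self_eq_zero.1 h2)
      · rintro ⟨_, x, rfl⟩
        obtain ⟨y, hy, w, hw, rfl⟩ :=
          Submodule.exists_add_mem_mem_orthogonal (K := LinearMap.ker (A : H →ₗ[ℂ] K)) x
        refine ⟨⟨w, hw⟩, Subtype.ext ?_⟩
        have : A y = 0 := hy
        simp [this])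

/-- The norm of `A x`, for `x` orthogonal to `ker A`, is the norm of `x`. -/
instance : NormedAddCommGroup (OperatorRange A) :=
  NormedAddCommGroup.induced _ _ (equiv A).symm.toLinearMap (equiv A).symm.injective

/-- The inner product of `A x` and `A y`, for `x, y` orthogonal to `ker A`, is that of `x, y`. -/
instance : InnerProductSpace ℂ (OperatorRange A) where
  norm_smul_le c x := by
    change ‖(equiv A).symm (c • x)‖ ≤ ‖c‖ * ‖(equiv A).symm x‖
    rw [map_smul, norm_smul]
  inner x y := inner ℂ ((equiv A).symm x) ((equiv A).symm y)
  norm_sq_eq_re_inner x := norm_sq_eq_re_inner (𝕜 := ℂ) ((equiv A).symm x)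
  conj_inner_symm x y := inner_conj_symm _ _
  add_left x y z := by simp only [map_add, inner_add_left]
  smul_left x y c := by simp only [map_smul, inner_smul_left]

/-- The isometric form of `equiv`. -/
def isometryEquiv : (LinearMap.ker (A : H →ₗ[ℂ] K))ᗮ ≃ₗᵢ[ℂ] OperatorRange A where
  toLinearEquiv := equiv A
  norm_map' x := congrArg norm ((equiv A).symm_apply_apply x)

theorem incl_isometryEquiv (x : (LinearMap.ker (A : H →ₗ[ℂ] K))ᗮ) :
    incl A (isometryEquiv A x) = A x := rfl

instance : CompleteSpace (OperatorRange A) :=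
  (completeSpace_congr (e := (isometryEquiv A).toEquiv)
    (isometryEquiv A).isometry.isUniformEmbedding).1 inferInstance

theorem continuous_incl : Continuous (incl A) := by
  have h : Continuous fun f : OperatorRange A => A ((isometryEquiv A).symm f : H) :=
    A.continuous.comp (continuous_subtype_val.comp (isometryEquiv A).symm.continuous)
  refine h.congr fun f => ?_
  rw [← incl_isometryEquiv, LinearIsometryEquiv.apply_symm_apply]

end OperatorRange

/-- The defect operator `(I - A A*)^{1/2}` of `A*`, for a contraction `A : H → K`. -/
def defect [CompleteSpace K] (A : H →L[ℂ] K) : K →L[ℂ] K :=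
  CFC.sqrt (1 - A ∘L ContinuousLinearMap.adjoint A)

/-- For a contraction `A : H → K`, the de Branges-Rovnyak space `H(A)`, the operator range of the
defect operator of `A*`. -/
abbrev ComplementarySpace [CompleteSpace K] (A : H →L[ℂ] K) : Type _ :=
  OperatorRange (defect A)

end OperatorRange

section Space

variable [CompleteSpace D] [CompleteSpace E] (B : SchurClass D E)

/-- The de Branges-Rovnyak space `H(B) = H(T_B)`. -/
abbrev SchurClass.Space : Type _ := ComplementarySpace B.mulOp

variable {B}

/-- The value at `z` (in the unit disc) of an element of `H(B)`, which is a function in `H²(E)`. -/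
def SchurClass.Space.eval (f : B.Space) (z : ℂ) : E :=
  H2.eval (OperatorRange.incl _ f) z

theorem SchurClass.Space.ext_eval {f g : B.Space} (h : ∀ z ∈ unitDisc, f.eval z = g.eval z) :
    f = g :=
  Subtype.ext (H2.ext_eval h)

theorem SchurClass.Space.eval_add (f g : B.Space) {z : ℂ} (hz : z ∈ unitDisc) :
    SchurClass.Space.eval (f + g) z = f.eval z + g.eval z := by
  unfold SchurClass.Space.eval
  rw [map_add, H2.eval_add _ _ hz]

theorem SchurClass.Space.eval_smul (c : ℂ) (f : B.Space) {z : ℂ} (hz : z ∈ unitDisc) :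
    SchurClass.Space.eval (c • f) z = c • f.eval z := by
  unfold SchurClass.Space.eval
  rw [map_smul, H2.eval_smul _ _ hz]

theorem SchurClass.Space.continuous_eval {z : ℂ} (hz : z ∈ unitDisc) :
    Continuous fun f : B.Space => f.eval z := by
  let φ : H2 E →ₗ[ℂ] E :=
    { toFun := fun f => f.eval z
      map_add' := fun f g => H2.eval_add f g hz
      map_smul' := fun c f => H2.eval_smul c f hz }
  have hφ : Continuous φ :=
    AddMonoidHomClass.continuous_of_bound φ _ fun f => H2.norm_eval_le f hz
  exact hφ.comp (OperatorRange.continuous_incl _)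

variable (B)

/-- `H(B)` is `M_z`-invariant: `z f ∈ H(B)` for every `f ∈ H(B)`. -/
def SchurClass.IsMzInvariant : Prop :=
  ∀ f : B.Space, ∃ g : B.Space, ∀ z ∈ unitDisc, g.eval z = z • f.eval z

variable {B}

/-- Multiplication by `z` on an `M_z`-invariant `H(B)`, as a linear map. -/
def SchurClass.mzLinear (h : B.IsMzInvariant) : B.Space →ₗ[ℂ] B.Space where
  toFun f := (h f).choose
  map_add' f g := SchurClass.Space.ext_eval fun z hz => by
    rw [SchurClass.Space.eval_add _ _ hz, (h (f + g)).choose_spec z hz, (h f).choose_spec z hz,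
      (h g).choose_spec z hz, SchurClass.Space.eval_add _ _ hz, smul_add]
  map_smul' c f := SchurClass.Space.ext_eval fun z hz => by
    rw [RingHom.id_apply, SchurClass.Space.eval_smul _ _ hz, (h (c • f)).choose_spec z hz,
      (h f).choose_spec z hz, SchurClass.Space.eval_smul _ _ hz, smul_comm]

theorem SchurClass.eval_mzLinear (h : B.IsMzInvariant) (f : B.Space) {z : ℂ} (hz : z ∈ unitDisc) :
    SchurClass.Space.eval (SchurClass.mzLinear h f) z = z • f.eval z :=
  (h f).choose_spec z hz

theorem SchurClass.isClosed_graph_mzLinear (h : B.IsMzInvariant) :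
    IsClosed ((SchurClass.mzLinear h).graph : Set (B.Space × B.Space)) := by
  have heq : ((SchurClass.mzLinear h).graph : Set (B.Space × B.Space)) =
      ⋂ z ∈ unitDisc, {p | SchurClass.Space.eval p.2 z = z • SchurClass.Space.eval p.1 z} := by
    ext p
    simp only [SetLike.mem_coe, LinearMap.mem_graph_iff, Set.mem_iInter, Set.mem_ofPred_eq]
    constructor
    · intro hp z hz
      rw [hp, SchurClass.eval_mzLinear h _ hz]
    · intro hp
      refine SchurClass.Space.ext_eval fun z hz => ?_
      rw [hp z hz, SchurClass.eval_mzLinear h _ hz]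
  rw [heq]
  refine isClosed_biInter fun z hz => isClosed_eq ?_ ?_
  · exact (SchurClass.Space.continuous_eval hz).comp continuous_snd
  · exact ((SchurClass.Space.continuous_eval hz).comp continuous_fst).const_smul z

/-- The bounded operator `M_z` of multiplication by `z` on an `M_z`-invariant `H(B)`. -/
def SchurClass.mz (h : B.IsMzInvariant) : B.Space →L[ℂ] B.Space :=
  ContinuousLinearMap.ofIsClosedGraph (SchurClass.isClosed_graph_mzLinear h)

theorem SchurClass.eval_mz (h : B.IsMzInvariant) (f : B.Space) {z : ℂ} (hz : z ∈ unitDisc) :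
    SchurClass.Space.eval (SchurClass.mz h f) z = z • f.eval z :=
  SchurClass.eval_mzLinear h f hz

end Space

section Row

variable [CompleteSpace D] {B : SchurClass D ℂ}

/-- The element `f` of `H(B)` is the (restriction to the disc of the) polynomial `p`. -/
def SchurClass.Space.IsPoly (f : B.Space) (p : Polynomial ℂ) : Prop :=
  ∀ z ∈ unitDisc, f.eval z = p.eval z

variable (B)

/-- The polynomials are contained in `H(B)` and are dense in it. -/
def SchurClass.PolynomialsDense : Prop :=
  (∀ p : Polynomial ℂ, ∃ f : B.Space, f.IsPoly p) ∧
    Dense {f : B.Space | ∃ p : Polynomial ℂ, f.IsPoly p}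

/-- For a polynomial `q`, the closure `[q]` in `H(B)` of the polynomial multiples of `q`. -/
def SchurClass.closedSpan (q : Polynomial ℂ) : Set B.Space :=
  closure {f : B.Space | ∃ p : Polynomial ℂ, f.IsPoly (q * p)}

end Row

/-- The non-tangential approach region `Γ_α(ζ)` with vertex `ζ` in the unit circle. -/
def stolzRegion (α : ℝ) (ζ : ℂ) : Set ℂ :=
  {z | z ∈ unitDisc ∧ ‖z - ζ‖ < α * (1 - ‖z‖)}

/-- The function `f` on the unit disc has the non-tangential limit `l` at `ζ`. -/
def HasNontangentialLimit (f : ℂ → ℂ) (ζ l : ℂ) : Prop :=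
  ∀ α : ℝ, 1 < α → Filter.Tendsto f (𝓝[stolzRegion α ζ] ζ) (𝓝 l)

end DeBrangesRovnyak

end

/-! The equivalence of (i), (ii), (iii) is Hilbert space duality. The Riesz vector of `e` is an
eigenvector of `M_z*`, because `e(zp) = ζ e(p)` on the dense polynomials. An eigenvector is
orthogonal to every `(z - ζ)p`. Conversely, since `z - ζ` divides `p - p(ζ)`, a nonzero vector
orthogonal to `[z - ζ]` is, up to a nonzero scalar, a representing vector for evaluation at `ζ`.
(iv) gives (i) by Banach–Steinhaus along a radius.

The substance is (i) ⇒ (iv), which rests on the backward shift `L f = (f - f(0))/z` being a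
contraction on `H(B)`. Write `S` for the shift on `H²`. As `T_B` intertwines the shifts, `‖T_B* h‖ ≤
‖T_B* S h‖`, so the defect operator `Δ = (I - T_B T_B*)^{1/2}` satisfies `‖Δ S h‖ ≤ ‖Δ h‖`; by a
Douglas-type argument (`OperatorRange.exists_contraction`) `S*` acts contractively on the range of
`Δ`.

On polynomials, hence everywhere, `e(g - ζ L g) = g(0)`. Given `z` in the disc, solve `f = g - z L
g`. Then `f(z) = g(0) = e(f + (z - ζ) L g)` with `‖L g‖ ≤ ‖g‖ ≤ ‖f‖ / (1 - |z|)`, so point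
evaluations are uniformly bounded, by `‖e‖ (1 + α)`, on each approach region
(`SchurClass.norm_eval_le_of_mem_stolzRegion`). Approximation by polynomials then yields the limit
`e(f)`. -/

namespace DeBrangesRovnyak

/-! ### The shift on the Hardy space and its adjoint -/

section Shift

variable {D E : Type*} [NormedAddCommGroup D] [InnerProductSpace ℂ D]
  [NormedAddCommGroup E] [InnerProductSpace ℂ E]

/-- The sequence `0, f 0, f 1, …`. -/
def shiftSeq {E : Type*} [NormedAddCommGroup E] (f : ℕ → E) : ℕ → E
  | 0 => 0
  | n + 1 => f n

theorem H2.hasSum_norm_sq_shiftSeq {E : Type*} [NormedAddCommGroup E] (f : H2 E) :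
    HasSum (fun n => ‖shiftSeq f n‖ ^ 2) (‖f‖ ^ 2) := by
  refine (hasSum_nat_add_iff' 1).1 ?_
  simpa [shiftSeq] using f.hasSum_norm_sq

/-- The shift `f ↦ z f` on `H²(E)`, as an isometry. -/
noncomputable def H2.shift : H2 E →ₗᵢ[ℂ] H2 E where
  toFun f := ⟨shiftSeq f, memℓp_gen (by simpa using f.hasSum_norm_sq_shiftSeq.summable)⟩
  map_add' f g := by
    ext n
    cases n
    · exact (add_zero (0 : E)).symm
    · rfl
  map_smul' c f := by
    ext n
    cases n
    · exact (smul_zero c).symm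
    · rfl
  norm_map' f := by
    have h : ‖_‖ ^ 2 = ‖f‖ ^ 2 := (H2.hasSum_norm_sq
      (⟨shiftSeq f, memℓp_gen (by simpa using f.hasSum_norm_sq_shiftSeq.summable)⟩ : H2 E)).unique
      f.hasSum_norm_sq_shiftSeq
    exact (pow_left_inj₀ (norm_nonneg _) (norm_nonneg _) two_ne_zero).1 h

@[simp]
theorem H2.shift_zero (f : H2 E) : H2.shift f 0 = 0 := rfl

@[simp]
theorem H2.shift_succ (f : H2 E) (n : ℕ) : H2.shift f (n + 1) = f n := rfl

theorem H2.eval_zero (f : H2 E) : f.eval 0 = f 0 := by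
  unfold H2.eval
  rw [tsum_eq_single 0 fun n hn => by simp [hn]]
  simp

theorem H2.eval_single_zero (c : E) (z : ℂ) :
    H2.eval (lp.single 2 0 c : H2 E) z = c := by
  unfold H2.eval
  rw [tsum_eq_single 0 fun n hn => by
    rw [lp.single_apply_ne _ _ _ hn, smul_zero], lp.single_apply_self]
  simp

theorem H2.eval_shift [CompleteSpace E] (f : H2 E) {z : ℂ} (hz : z ∈ unitDisc) :
    (H2.shift f).eval z = z • f.eval z := by
  refine (H2.hasSum_eval _ hz).unique ((hasSum_nat_add_iff' 1).1 ?_)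
  simpa [pow_succ', mul_smul] using (f.hasSum_eval hz).const_smul z

variable [CompleteSpace E]

theorem H2.adjoint_shift_apply (f : H2 E) (n : ℕ) :
    (ContinuousLinearMap.adjoint (H2.shift (E := E)).toContinuousLinearMap f : H2 E) n
      = f (n + 1) := by
  refine ext_inner_left ℂ fun v => ?_
  refine (lp.inner_single_left (𝕜 := ℂ) (G := fun _ : ℕ => E) n v _).symm.trans ?_
  refine Eq.trans ?_ (lp.inner_single_left (𝕜 := ℂ) (G := fun _ : ℕ => E) (n + 1) v f)
  rw [ContinuousLinearMap.adjoint_inner_right]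
  -- What remains is that the shift carries the vector `v` in degree `n` to degree `n + 1`.
  congr 1
  ext k
  rcases k with _ | k
  · rw [lp.single_apply_ne _ _ _ (by simp)]; rfl
  · change lp.single (E := fun _ : ℕ => E) 2 n v k = _
    simp [lp.single_apply, Pi.single_apply]

/-- `f = f(0) + z · Lf`, for the backward shift `L`. -/
theorem H2.eval_adjoint_shift (f : H2 E) {z : ℂ} (hz : z ∈ unitDisc) :
    f.eval z = f 0 +
      z • H2.eval (ContinuousLinearMap.adjoint (H2.shift (E := E)).toContinuousLinearMap f) z := by
  have h : f = lp.single 2 0 (f 0) +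
      H2.shift (ContinuousLinearMap.adjoint (H2.shift (E := E)).toContinuousLinearMap f) := by
    ext n
    rcases n with _ | n
    · simp
    · rw [lp.coeFn_add, Pi.add_apply, H2.shift_succ, H2.adjoint_shift_apply,
        lp.single_apply_ne _ _ _ (by simp), zero_add]
  rw [← H2.eval_shift _ hz]
  conv_lhs => rw [h]
  rw [H2.eval_add _ _ hz, H2.eval_single_zero]

/-- The decomposition into a constant plus `z` times a function is unique. This identifies the
backward shift from values alone, as is needed to compute it on polynomials. -/
theorem H2.adjoint_shift_eq_of_eval {f g : H2 E} {c : E}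
    (h : ∀ z ∈ unitDisc, f.eval z = c + z • g.eval z) :
    ContinuousLinearMap.adjoint (H2.shift (E := E)).toContinuousLinearMap f = g := by
  have h' : f = lp.single 2 0 c + H2.shift g := H2.ext_eval fun z hz => by
    rw [h z hz, H2.eval_add _ _ hz, H2.eval_shift _ hz, H2.eval_single_zero]
  ext n
  rw [H2.adjoint_shift_apply, h', lp.coeFn_add, Pi.add_apply, H2.shift_succ,
    lp.single_apply_ne _ _ _ (by simp), zero_add]

variable [CompleteSpace D]

theorem SchurClass.mulOp_shift (B : SchurClass D E) (f : H2 D) :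
    B.mulOp (H2.shift f) = H2.shift (B.mulOp f) := H2.ext_eval fun z hz => by
  rw [B.eval_mulOp _ hz, H2.eval_shift _ hz, H2.eval_shift _ hz, B.eval_mulOp _ hz, map_smul]

theorem SchurClass.norm_mulOp_le (B : SchurClass D E) : ‖B.mulOp‖ ≤ 1 :=
  LinearMap.mkContinuous_norm_le _ zero_le_one _

/-- Since `T_B` intertwines the shifts and the shift is isometric, `T_B* = S* T_B* S`, and `S*` is a
contraction. The proof tests this identity against `g = T_B* h` and cancels one factor `‖g‖`. -/
theorem SchurClass.norm_adjoint_mulOp_le (B : SchurClass D E) (h : H2 E) :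
    ‖ContinuousLinearMap.adjoint B.mulOp h‖ ≤
      ‖ContinuousLinearMap.adjoint B.mulOp (H2.shift h)‖ := by
  set g := ContinuousLinearMap.adjoint B.mulOp h with hg
  have h1 : inner ℂ g g =
      inner ℂ (ContinuousLinearMap.adjoint B.mulOp (H2.shift h)) (H2.shift g) := by
    rw [ContinuousLinearMap.adjoint_inner_left B.mulOp (H2.shift g), B.mulOp_shift,
      LinearIsometry.inner_map_map]
    conv_lhs => rw [hg]
    rw [ContinuousLinearMap.adjoint_inner_left]
  have h2 : ‖g‖ * ‖g‖ ≤ ‖ContinuousLinearMap.adjoint B.mulOp (H2.shift h)‖ * ‖g‖ := by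
    rw [← inner_self_eq_norm_mul_norm (𝕜 := ℂ), h1]
    exact (re_inner_le_norm _ _).trans_eq (by rw [LinearIsometry.norm_map])
  rcases (norm_nonneg g).eq_or_lt with h0 | h0
  · rw [← h0]; exact norm_nonneg _
  · exact le_of_mul_le_mul_right h2 h0

end Shift

/-! ### Operator ranges, contractions on them, and defect operators -/

section OperatorRange

variable {H K : Type*} [NormedAddCommGroup H] [InnerProductSpace ℂ H] [CompleteSpace H]
  [NormedAddCommGroup K] [InnerProductSpace ℂ K]

/-- The inclusion of `M(A)` in `K`, as a bounded operator. -/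
noncomputable def OperatorRange.inclL (A : H →L[ℂ] K) : OperatorRange A →L[ℂ] K :=
  ⟨OperatorRange.incl A, OperatorRange.continuous_incl A⟩

variable [CompleteSpace K]

/-- The range of `A*` lies in `(ker A)ᗮ`, on which `A` is the isometry onto `M(A)` followed by the
inclusion. Hence the adjoint of the inclusion sends `h` to the image of `A* h` under that isometry.
-/
theorem OperatorRange.norm_adjoint_inclL (A : H →L[ℂ] K) (h : K) :
    ‖ContinuousLinearMap.adjoint (inclL A) h‖ = ‖ContinuousLinearMap.adjoint A h‖ := by
  have hm : ContinuousLinearMap.adjoint A h ∈ (LinearMap.ker (A : H →ₗ[ℂ] K))ᗮ := by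
    rw [Submodule.mem_orthogonal]
    intro u hu
    have hu' : A u = 0 := hu
    rw [ContinuousLinearMap.adjoint_inner_right, hu', inner_zero_left]
  have key : ContinuousLinearMap.adjoint (inclL A) h =
      isometryEquiv A ⟨ContinuousLinearMap.adjoint A h, hm⟩ := by
    refine ext_inner_left ℂ fun v => ?_
    obtain ⟨x, rfl⟩ := (isometryEquiv A).surjective v
    rw [LinearIsometryEquiv.inner_map_map, ContinuousLinearMap.adjoint_inner_right]
    change inner ℂ (A x) h = inner ℂ (x : H) (ContinuousLinearMap.adjoint A h)
    rw [ContinuousLinearMap.adjoint_inner_right]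
  rw [key, LinearIsometryEquiv.norm_map]
  rfl

/-- The inclusion is injective, so its adjoint has dense range. -/
theorem OperatorRange.denseRange_adjoint_inclL (A : H →L[ℂ] K) :
    DenseRange (ContinuousLinearMap.adjoint (inclL A)) := by
  have h : (LinearMap.range (ContinuousLinearMap.adjoint (inclL A)).toLinearMap)ᗮ = ⊥ := by
    rw [Submodule.eq_bot_iff]
    intro x hx
    rw [Submodule.mem_orthogonal'] at hx
    have h0 : inclL A x = 0 := by
      have := hx _ (LinearMap.mem_range_self _ (inclL A x))
      rw [ContinuousLinearMap.coe_coe, ContinuousLinearMap.adjoint_inner_right] at this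
      exact inner_self_eq_zero.1 this
    exact Subtype.ext h0
  have := (Submodule.topologicalClosure_eq_top_iff).2 h
  exact (Submodule.dense_iff_topologicalClosure_eq_top).2 this

/-- If `‖A* T h‖ ≤ ‖A* h‖` for all `h`, then `T*` acts on `M(A)` as a contraction. -/
theorem OperatorRange.exists_contraction (A : H →L[ℂ] K) (T : K →L[ℂ] K)
    (hT : ∀ h, ‖ContinuousLinearMap.adjoint A (T h)‖ ≤ ‖ContinuousLinearMap.adjoint A h‖) :
    ∃ R : OperatorRange A →L[ℂ] OperatorRange A, ‖R‖ ≤ 1 ∧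
      ∀ f, incl A (R f) = ContinuousLinearMap.adjoint T (incl A f) := by
  -- With `ι` the inclusion, the hypothesis makes `ι* h ↦ ι* T h` well defined and contractive on
  -- the dense range of `ι*`. The adjoint `R` of its extension satisfies `ι R = T* ι`.
  let e := (ContinuousLinearMap.adjoint (inclL A)).toLinearMap
  let u := (ContinuousLinearMap.adjoint (inclL A) ∘L T).toLinearMap
  have hd : DenseRange e := denseRange_adjoint_inclL A
  have hu : ∀ h, ‖u h‖ ≤ 1 * ‖e h‖ := fun h => by
    change ‖ContinuousLinearMap.adjoint (inclL A) (T h)‖ ≤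
      1 * ‖ContinuousLinearMap.adjoint (inclL A) h‖
    rw [one_mul, norm_adjoint_inclL, norm_adjoint_inclL]
    exact hT h
  refine ⟨ContinuousLinearMap.adjoint (u.extendOfNorm e), ?_, fun f => ?_⟩
  · rw [LinearIsometryEquiv.norm_map]
    exact LinearMap.opNorm_extendOfNorm_le hd zero_le_one hu
  · refine ext_inner_right ℂ fun h => ?_
    rw [ContinuousLinearMap.adjoint_inner_left]
    change inner ℂ (inclL A _) h = inner ℂ (inclL A f) (T h)
    rw [← ContinuousLinearMap.adjoint_inner_right, ContinuousLinearMap.adjoint_inner_left,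
      ← ContinuousLinearMap.adjoint_inner_right (inclL A) f]
    congr 1
    exact LinearMap.extendOfNorm_eq hd ⟨1, hu⟩ h

theorem isSelfAdjoint_defect (A : H →L[ℂ] K) : IsSelfAdjoint (defect A) :=
  (CFC.sqrt_nonneg _).isSelfAdjoint

/-- The defect operator is self-adjoint with square `I - A A*`, so the left side is the quadratic
form of `I - A A*` at `h`. -/
theorem norm_sq_defect {A : H →L[ℂ] K} (hA : ‖A‖ ≤ 1) (h : K) :
    ‖defect A h‖ ^ 2 = ‖h‖ ^ 2 - ‖ContinuousLinearMap.adjoint A h‖ ^ 2 := by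
  have hre : ∀ h, RCLike.re (inner ℂ ((1 - A ∘L ContinuousLinearMap.adjoint A) h) h) =
      ‖h‖ ^ 2 - ‖ContinuousLinearMap.adjoint A h‖ ^ 2 := by
    intro h
    rw [sub_apply, inner_sub_left, map_sub, ContinuousLinearMap.comp_apply, one_apply_eq_self,
      ← ContinuousLinearMap.adjoint_inner_right A, inner_self_eq_norm_sq, inner_self_eq_norm_sq]
  -- Contractivity of `A` enters here: the square root squares back to `I - A A*` only when that
  -- operator is nonnegative.
  have hpos : 0 ≤ 1 - A ∘L ContinuousLinearMap.adjoint A := by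
    rw [ContinuousLinearMap.nonneg_iff_isPositive, ContinuousLinearMap.isPositive_def']
    refine ⟨(IsSelfAdjoint.one _).sub ?_, fun x => ?_⟩
    · have := A.adjoint.isPositive_adjoint_comp_self.isSelfAdjoint
      rwa [ContinuousLinearMap.adjoint_adjoint] at this
    · rw [ContinuousLinearMap.reApplyInnerSelf_apply, hre, sub_nonneg]
      refine pow_le_pow_left₀ (norm_nonneg _) ?_ 2
      have : ‖ContinuousLinearMap.adjoint A‖ ≤ 1 := by rwa [LinearIsometryEquiv.norm_map]
      simpa using (ContinuousLinearMap.adjoint A).le_of_opNorm_le this x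
  rw [← hre, ← CFC.sqrt_mul_sqrt_self (1 - A ∘L ContinuousLinearMap.adjoint A) hpos]
  change _ = RCLike.re (inner ℂ (defect A (defect A h)) h)
  rw [← ContinuousLinearMap.adjoint_inner_right,
    (isSelfAdjoint_defect A).adjoint_eq, inner_self_eq_norm_sq]

end OperatorRange

/-! ### The backward shift on `H(B)` -/

/-- The backward shift acts as a contraction on `H(B)`. -/
theorem SchurClass.exists_backwardShift {D E : Type*} [NormedAddCommGroup D]
    [InnerProductSpace ℂ D] [NormedAddCommGroup E] [InnerProductSpace ℂ E] [CompleteSpace D]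
    [CompleteSpace E] (B : SchurClass D E) :
    ∃ L : B.Space →L[ℂ] B.Space, ‖L‖ ≤ 1 ∧
      (∀ (f : B.Space), ∀ z ∈ unitDisc, f.eval z = f.eval 0 + z • (L f).eval z) ∧
      ∀ (f g : B.Space) (c : E), (∀ z ∈ unitDisc, f.eval z = c + z • g.eval z) → L f = g := by
  obtain ⟨L, hL, hLf⟩ := OperatorRange.exists_contraction (defect B.mulOp)
    (H2.shift (E := E)).toContinuousLinearMap fun h => by
      rw [(isSelfAdjoint_defect _).adjoint_eq]
      refine (pow_le_pow_iff_left₀ (norm_nonneg _) (norm_nonneg _) two_ne_zero).1 ?_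
      -- The shift preserves the first term `‖h‖²` and does not decrease the subtracted one.
      rw [norm_sq_defect B.norm_mulOp_le, norm_sq_defect B.norm_mulOp_le]
      have h1 := pow_le_pow_left₀ (norm_nonneg _) (B.norm_adjoint_mulOp_le h) 2
      have h2 : ‖(H2.shift (E := E)).toContinuousLinearMap h‖ = ‖h‖ :=
        LinearIsometry.norm_map _ h
      rw [h2]
      exact sub_le_sub_left h1 _
  refine ⟨L, hL, fun f z hz => ?_, fun f g c h => Subtype.ext ?_⟩
  · unfold SchurClass.Space.eval
    rw [hLf, H2.eval_zero]
    exact H2.eval_adjoint_shift _ hz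
  · exact (hLf f).trans (H2.adjoint_shift_eq_of_eval h)

end DeBrangesRovnyak

namespace DeBrangesRovnyak

variable {D : Type*} [NormedAddCommGroup D] [InnerProductSpace ℂ D] [CompleteSpace D]
  {B : SchurClass D ℂ}

/-! ### Polynomials and point evaluations in `H(B)` -/

theorem SchurClass.Space.IsPoly.unique {f g : B.Space} {p : Polynomial ℂ} (hf : f.IsPoly p)
    (hg : g.IsPoly p) : f = g :=
  SchurClass.Space.ext_eval fun z hz => (hf z hz).trans (hg z hz).symm

/-- The embedding of the polynomials in `H(B)`. -/
noncomputable def SchurClass.PolynomialsDense.poly (h : B.PolynomialsDense) :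
    Polynomial ℂ →ₗ[ℂ] B.Space where
  toFun p := (h.1 p).choose
  map_add' p q := SchurClass.Space.ext_eval fun z hz => by
    rw [SchurClass.Space.eval_add _ _ hz, (h.1 _).choose_spec z hz, (h.1 _).choose_spec z hz,
      (h.1 _).choose_spec z hz, Polynomial.eval_add]
  map_smul' c p := SchurClass.Space.ext_eval fun z hz => by
    rw [RingHom.id_apply, SchurClass.Space.eval_smul _ _ hz, (h.1 _).choose_spec z hz,
      (h.1 _).choose_spec z hz, Polynomial.eval_smul]

theorem SchurClass.PolynomialsDense.isPoly (h : B.PolynomialsDense) (p : Polynomial ℂ) :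
    (h.poly p).IsPoly p := (h.1 p).choose_spec

theorem SchurClass.PolynomialsDense.eq_poly (h : B.PolynomialsDense) {f : B.Space}
    {p : Polynomial ℂ} (hf : f.IsPoly p) : f = h.poly p := hf.unique (h.isPoly p)

theorem SchurClass.PolynomialsDense.denseRange_poly (h : B.PolynomialsDense) :
    DenseRange h.poly := by
  refine h.2.mono ?_
  rintro f ⟨p, hp⟩
  exact ⟨p, (h.eq_poly hp).symm⟩

theorem SchurClass.PolynomialsDense.mz_poly (h : B.PolynomialsDense) (hinv : B.IsMzInvariant)
    (p : Polynomial ℂ) : SchurClass.mz hinv (h.poly p) = h.poly (Polynomial.X * p) :=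
  h.eq_poly fun z hz => by
    rw [SchurClass.eval_mz hinv _ hz, h.isPoly p z hz, Polynomial.eval_mul, Polynomial.eval_X,
      smul_eq_mul]

/-- Exhibits `[q]` as a closed subspace, so that being proper means having a nonzero orthogonal
vector. -/
theorem SchurClass.PolynomialsDense.closedSpan_eq (h : B.PolynomialsDense) (q : Polynomial ℂ) :
    B.closedSpan q = (LinearMap.range
      (h.poly ∘ₗ LinearMap.mulLeft ℂ q)).topologicalClosure := by
  rw [Submodule.topologicalClosure_coe]
  unfold SchurClass.closedSpan
  congr 1
  ext f
  constructor
  · rintro ⟨p, hp⟩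
    exact ⟨p, (h.eq_poly hp).symm⟩
  · rintro ⟨p, rfl⟩
    exact ⟨p, h.isPoly _⟩

/-- Evaluation at a point of the disc, as a bounded functional on `H(B)`. -/
noncomputable def SchurClass.Space.evalL (B : SchurClass D ℂ) {z : ℂ} (hz : z ∈ unitDisc) :
    B.Space →L[ℂ] ℂ where
  toFun f := f.eval z
  map_add' f g := SchurClass.Space.eval_add f g hz
  map_smul' c f := SchurClass.Space.eval_smul c f hz
  cont := SchurClass.Space.continuous_eval hz

/-! ### Bounded evaluation, eigenvectors of `M_z*`, and `[z - ζ]` -/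

variable {ζ : ℂ}

/-- The eigenvector is the Riesz representative `k` of `e`; it is nonzero because `e(1) = 1`. -/
theorem SchurClass.hasEigenvalue_of_eval_bounded (hinv : B.IsMzInvariant)
    (hdense : B.PolynomialsDense) {e : B.Space →L[ℂ] ℂ}
    (he : ∀ p, e (hdense.poly p) = p.eval ζ) :
    Module.End.HasEigenvalue
      ((ContinuousLinearMap.adjoint (SchurClass.mz hinv) : B.Space →L[ℂ] B.Space) :
        Module.End ℂ B.Space) (conj ζ) := by
  let k : B.Space := (InnerProductSpace.toDual ℂ B.Space).symm e
  have hk : ∀ f, inner ℂ k f = e f := fun f => InnerProductSpace.toDual_symm_apply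
  refine Module.End.hasEigenvalue_of_hasEigenvector (x := k) ⟨?_, ?_⟩
  · rw [Module.End.mem_eigenspace_iff]
    change ContinuousLinearMap.adjoint (SchurClass.mz hinv) k = conj ζ • k
    refine ext_inner_right ℂ fun f => ?_
    rw [ContinuousLinearMap.adjoint_inner_left, inner_smul_left, Complex.conj_conj, hk, hk]
    refine congrFun (hdense.denseRange_poly.equalizer
      (e.continuous.comp (SchurClass.mz hinv).continuous) (e.continuous.const_smul ζ) ?_) f
    ext p
    simp [hdense.mz_poly hinv, he]
  · intro h0
    have h1 := he 1
    rw [← hk, h0, inner_zero_left, Polynomial.eval_one] at h1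
    exact zero_ne_one h1

/-- An eigenvector is orthogonal to the range of `M_z - ζ`, hence to `[z - ζ]`; were this
everything, the eigenvector would be orthogonal to itself. -/
theorem SchurClass.closedSpan_ne_univ_of_hasEigenvalue (hinv : B.IsMzInvariant)
    (hdense : B.PolynomialsDense)
    (h : Module.End.HasEigenvalue
      ((ContinuousLinearMap.adjoint (SchurClass.mz hinv) : B.Space →L[ℂ] B.Space) :
        Module.End ℂ B.Space) (conj ζ)) :
    B.closedSpan (Polynomial.X - Polynomial.C ζ) ≠ Set.univ := by
  obtain ⟨k, hk⟩ := h.exists_hasEigenvector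
  have hk1 : ContinuousLinearMap.adjoint (SchurClass.mz hinv) k = conj ζ • k := hk.apply_eq_smul
  intro huniv
  refine hk.2 (inner_self_eq_zero (𝕜 := ℂ).1 ?_)
  have hsub : B.closedSpan (Polynomial.X - Polynomial.C ζ) ⊆ {f | inner ℂ k f = 0} := by
    refine closure_minimal ?_ (isClosed_eq (by fun_prop) continuous_const)
    rintro f ⟨p, hp⟩
    have hf : f = SchurClass.mz hinv (hdense.poly p) - ζ • hdense.poly p := by
      rw [hdense.eq_poly hp, hdense.mz_poly, ← map_smul, ← map_sub, sub_mul,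
        Polynomial.C_mul']
    rw [Set.mem_ofPred_eq, hf, inner_sub_right, ← ContinuousLinearMap.adjoint_inner_left, hk1,
      inner_smul_left, inner_smul_right, Complex.conj_conj, sub_self]
  exact hsub (huniv ▸ Set.mem_univ k)

theorem SchurClass.exists_eval_of_closedSpan_ne_univ (hdense : B.PolynomialsDense)
    (h : B.closedSpan (Polynomial.X - Polynomial.C ζ) ≠ Set.univ) :
    ∃ e : B.Space →L[ℂ] ℂ, ∀ p, e (hdense.poly p) = p.eval ζ := by
  rw [hdense.closedSpan_eq, Ne, Submodule.coe_eq_univ,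
    Submodule.topologicalClosure_eq_top_iff] at h
  obtain ⟨v, hv, hv0⟩ := Submodule.exists_mem_ne_zero_of_ne_bot h
  have hv' : ∀ p, inner ℂ v (hdense.poly p) = p.eval ζ * inner ℂ v (hdense.poly 1) := by
    intro p
    obtain ⟨q, hq⟩ := Polynomial.X_sub_C_dvd_sub_C_eval (a := ζ) (p := p)
    have h1 : inner ℂ v (hdense.poly ((Polynomial.X - Polynomial.C ζ) * q)) = 0 :=
      (Submodule.mem_orthogonal' _ _).1 hv _ (LinearMap.mem_range_self
        (hdense.poly ∘ₗ LinearMap.mulLeft ℂ (Polynomial.X - Polynomial.C ζ)) q)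
    rw [← hq, map_sub, inner_sub_right, sub_eq_zero, ← mul_one (Polynomial.C _),
      Polynomial.C_mul', map_smul, inner_smul_right] at h1
    exact h1
  -- Otherwise `hv'` makes `v` orthogonal to all polynomials, hence zero by density. So `⟨v, ·⟩` can
  -- be normalized to take the value `1` at the polynomial `1`.
  have h1 : inner ℂ v (hdense.poly 1) ≠ 0 := by
    intro h0
    refine hv0 (inner_self_eq_zero (𝕜 := ℂ).1 ?_)
    have hc : Continuous fun f : B.Space => inner ℂ v f := by fun_prop
    refine congrFun (hdense.denseRange_poly.equalizer hc (continuous_const (y := (0 : ℂ))) ?_) v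
    ext p
    rw [Function.comp_apply, hv' p, h0, mul_zero, Function.comp_apply]
  refine ⟨(inner ℂ v (hdense.poly 1))⁻¹ • innerSL ℂ v, fun p => ?_⟩
  rw [smul_apply, innerSL_apply_apply, hv' p, smul_eq_mul, mul_comm, mul_assoc,
    mul_inv_cancel₀ h1, mul_one]

/-! ### Bounded evaluation and non-tangential limits -/

/-- If evaluation at `ζ` is bounded on the polynomials, then evaluation at the points of a
non-tangential approach region at `ζ` is uniformly bounded. -/
theorem SchurClass.norm_eval_le_of_mem_stolzRegion (hdense : B.PolynomialsDense)
    {e : B.Space →L[ℂ] ℂ} (he : ∀ p, e (hdense.poly p) = p.eval ζ) {α : ℝ} {z : ℂ}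
    (hz : z ∈ stolzRegion α ζ) (f : B.Space) :
    ‖f.eval z‖ ≤ ‖e‖ * (1 + α) * ‖f‖ := by
  obtain ⟨L, hL, hLeval, hLeq⟩ := B.exists_backwardShift
  have hz1 : ‖z‖ < 1 := by simpa using hz.1
  -- For a polynomial, `L p` is `p.divX` and `p(ζ) - ζ (L p)(ζ) = p(0)`; both sides are continuous
  -- in `g`.
  have hLe : ∀ g : B.Space, e (g - ζ • L g) = g.eval 0 := by
    have h0 : (0 : ℂ) ∈ unitDisc := by simp
    have hc : Continuous fun g : B.Space => e (g - ζ • L g) := by fun_prop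
    refine congrFun (hdense.denseRange_poly.equalizer hc (SchurClass.Space.continuous_eval h0) ?_)
    ext p
    have hdiv : ∀ w, p.eval w = p.coeff 0 + w * p.divX.eval w := fun w => by
      rw [add_comm, mul_comm]
      simpa only [Polynomial.eval_add, Polynomial.eval_mul, Polynomial.eval_X, Polynomial.eval_C]
        using congrArg (Polynomial.eval w) p.divX_mul_X_add.symm
    have hp : L (hdense.poly p) = hdense.poly p.divX := by
      refine hLeq _ _ (p.coeff 0) fun z hz => ?_
      rw [hdense.isPoly _ z hz, hdense.isPoly _ z hz, hdiv, smul_eq_mul]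
    simp only [Function.comp_apply]
    rw [hp, map_sub, map_smul, he, he, hdense.isPoly p 0 h0, hdiv ζ, smul_eq_mul,
      ← Polynomial.coeff_zero_eq_eval_zero]
    ring
  have hzL : ‖z • L‖ < 1 := by
    rw [norm_smul]
    exact (mul_le_of_le_one_right (norm_nonneg z) hL).trans_lt hz1
  -- `1 - z L` is invertible by the Neumann series, since `‖z L‖ < 1`.
  obtain ⟨g, hg⟩ : ∃ g, g - z • L g = f := by
    refine ⟨(Units.oneSub (z • L) hzL)⁻¹.1 f, ?_⟩
    exact congrArg (fun T : B.Space →L[ℂ] B.Space => T f) (Units.oneSub (z • L) hzL).mul_inv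
  have hLg : ∀ g, ‖L g‖ ≤ ‖g‖ := fun g => by simpa using L.le_of_opNorm_le hL g
  have hgn : ‖g‖ * (1 - ‖z‖) ≤ ‖f‖ := by
    have h1 : ‖g‖ ≤ ‖f‖ + ‖z‖ * ‖L g‖ := by
      rw [← norm_smul, ← hg]
      simpa using norm_add_le (g - z • L g) (z • L g)
    nlinarith [mul_le_mul_of_nonneg_left (hLg g) (norm_nonneg z)]
  -- Evaluating `f = g - z L g` at `z` itself leaves `g(0)`, which `hLe` turns into `e(g - ζ L g)`.
  have hfz : f.eval z = e (f + (z - ζ) • L g) := by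
    have h1 : f + (z - ζ) • L g = g - ζ • L g := by
      rw [← hg, sub_smul]; abel
    rw [h1, hLe, ← hg, sub_eq_add_neg, ← neg_smul, SchurClass.Space.eval_add _ _ hz.1,
      SchurClass.Space.eval_smul _ _ hz.1, hLeval g z hz.1, neg_smul]
    simp
  have hα : ‖z - ζ‖ ≤ α * (1 - ‖z‖) := hz.2.le
  have hα0 : 0 ≤ α := by
    by_contra! h
    nlinarith [norm_nonneg (z - ζ)]
  rw [hfz, mul_assoc]
  refine e.le_opNorm_of_le ?_
  calc ‖f + (z - ζ) • L g‖ ≤ ‖f‖ + ‖z - ζ‖ * ‖L g‖ := by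
        rw [← norm_smul]; exact norm_add_le _ _
    _ ≤ ‖f‖ + α * (1 - ‖z‖) * ‖g‖ := by gcongr; exact hLg g
    _ ≤ (1 + α) * ‖f‖ := by nlinarith [mul_le_mul_of_nonneg_left hgn hα0]

theorem SchurClass.hasNontangentialLimit (hdense : B.PolynomialsDense)
    {e : B.Space →L[ℂ] ℂ} (he : ∀ p, e (hdense.poly p) = p.eval ζ) (f : B.Space) :
    HasNontangentialLimit f.eval ζ (e f) := by
  intro α hα
  have hC : 0 < ‖e‖ * (1 + α) + ‖e‖ + 1 := by positivity
  rw [Metric.tendsto_nhds]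
  intro ε hε
  -- The error `f - p` is counted twice: at `z`, with factor `‖e‖ (1 + α)`, and under `e`, with
  -- factor `‖e‖`. The extra `1` keeps the divisor positive when `e = 0`.
  obtain ⟨p, hp⟩ := hdense.denseRange_poly.exists_dist_lt f
    (show 0 < ε / 2 / (‖e‖ * (1 + α) + ‖e‖ + 1) by positivity)
  rw [lt_div_iff₀ hC, dist_eq_norm] at hp
  have hpc : ∀ᶠ z in 𝓝[stolzRegion α ζ] ζ, dist (p.eval z) (p.eval ζ) < ε / 2 :=
    (p.continuous.tendsto ζ).mono_left nhdsWithin_le_nhds |>.eventually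
      (Metric.ball_mem_nhds _ (half_pos hε))
  filter_upwards [hpc, self_mem_nhdsWithin] with z hz1 hz2
  have h1 := SchurClass.norm_eval_le_of_mem_stolzRegion hdense he hz2 (f - hdense.poly p)
  have h2 : SchurClass.Space.eval (f - hdense.poly p) z = f.eval z - p.eval z := by
    rw [← hdense.isPoly p z hz2.1]
    exact map_sub (SchurClass.Space.evalL B hz2.1) _ _
  have h3 := e.le_opNorm (f - hdense.poly p)
  rw [map_sub, he, norm_sub_rev] at h3
  rw [h2] at h1
  rw [dist_eq_norm] at hz1 ⊢
  have h4 : f.eval z - e f = (f.eval z - p.eval z) + (p.eval z - p.eval ζ) + (p.eval ζ - e f) := by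
    ring
  rw [h4]
  refine (norm_add₃_le).trans_lt ?_
  nlinarith [norm_nonneg (f - hdense.poly p)]

theorem SchurClass.exists_eval_of_hasNontangentialLimit (hdense : B.PolynomialsDense)
    (hζ : ‖ζ‖ = 1) (h : ∀ f : B.Space, ∃ l : ℂ, HasNontangentialLimit f.eval ζ l) :
    ∃ e : B.Space →L[ℂ] ℂ, ∀ p, e (hdense.poly p) = p.eval ζ := by
  choose l hl using h
  -- Radial points `r n ζ` have `|r n ζ - ζ| = 1 - r n`, so they lie in the region of aperture `2`;
  -- any aperture above `1` would do.
  let r : ℕ → ℝ := fun n => 1 - 1 / ((n : ℝ) + 1)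
  have hr1 : ∀ n, r n < 1 := fun n => sub_lt_self _ (by positivity)
  have hr0 : ∀ n, 0 ≤ r n := fun n => by
    refine sub_nonneg.2 ((div_le_one (by positivity)).2 ?_)
    simp
  have hn : ∀ n, ‖(r n : ℂ) * ζ‖ = r n := fun n => by
    rw [norm_mul, hζ, mul_one, Complex.norm_real, Real.norm_of_nonneg (hr0 n)]
  have hmem : ∀ n, (r n : ℂ) * ζ ∈ unitDisc := fun n => by
    rw [mem_ball_zero_iff, hn]; exact hr1 n
  have hstolz : ∀ n, (r n : ℂ) * ζ ∈ stolzRegion 2 ζ := fun n => by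
    refine ⟨hmem n, ?_⟩
    have h1 : (r n : ℂ) * ζ - ζ = ((r n - 1 : ℝ) : ℂ) * ζ := by push_cast; ring
    rw [hn, h1, norm_mul, hζ, mul_one, Complex.norm_real, Real.norm_eq_abs, abs_sub_comm,
      abs_of_pos (sub_pos.2 (hr1 n))]
    linarith [hr1 n]
  have hr : Filter.Tendsto r Filter.atTop (𝓝 1) := by
    simpa [r] using (tendsto_const_nhds (x := (1 : ℝ))).sub tendsto_one_div_add_atTop_nhds_zero_nat
  have hrζ : Filter.Tendsto (fun n => (r n : ℂ) * ζ) Filter.atTop (𝓝 ζ) := by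
    simpa using ((Complex.continuous_ofReal.tendsto 1).comp hr).mul_const ζ
  have hrs : Filter.Tendsto (fun n => (r n : ℂ) * ζ) Filter.atTop (𝓝[stolzRegion 2 ζ] ζ) :=
    tendsto_nhdsWithin_iff.2 ⟨hrζ, Filter.Eventually.of_forall hstolz⟩
  have hlim : Filter.Tendsto (fun n (f : B.Space) => SchurClass.Space.evalL B (hmem n) f)
      Filter.atTop (𝓝 l) :=
    tendsto_pi_nhds.2 fun f => (hl f 2 one_lt_two).comp hrs
  -- Banach–Steinhaus: a pointwise limit of bounded functionals on the complete space `H(B)` is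
  -- bounded.
  refine ⟨continuousLinearMapOfTendsto (fun n => SchurClass.Space.evalL B (hmem n)) hlim,
    fun p => ?_⟩
  change l (hdense.poly p) = p.eval ζ
  refine tendsto_nhds_unique (tendsto_pi_nhds.1 hlim (hdense.poly p)) ?_
  refine ((p.continuous.tendsto ζ).comp hrζ).congr fun n => ?_
  exact (hdense.isPoly p _ (hmem n)).symm

end DeBrangesRovnyak

theorem mainTheorem7 {D : Type*} [NormedAddCommGroup D] [InnerProductSpace ℂ D] [CompleteSpace D]
    [TopologicalSpace.SeparableSpace D] (B : DeBrangesRovnyak.SchurClass D ℂ)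
    (hinv : B.IsMzInvariant) (hdense : B.PolynomialsDense) (ζ : ℂ) (hζ : ‖ζ‖ = 1) :
    List.TFAE [
      ∃ e : B.Space →L[ℂ] ℂ, ∀ (p : Polynomial ℂ) (f : B.Space), f.IsPoly p → e f = p.eval ζ,
      Module.End.HasEigenvalue
        ((ContinuousLinearMap.adjoint (DeBrangesRovnyak.SchurClass.mz hinv) :
          B.Space →L[ℂ] B.Space) : Module.End ℂ B.Space) (conj ζ),
      B.closedSpan (Polynomial.X - Polynomial.C ζ) ≠ Set.univ,
      ∀ f : B.Space, ∃ l : ℂ, DeBrangesRovnyak.HasNontangentialLimit f.eval ζ l] := by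
  have key : (∃ e : B.Space →L[ℂ] ℂ, ∀ (p : Polynomial ℂ) (f : B.Space),
      f.IsPoly p → e f = p.eval ζ) ↔
      ∃ e : B.Space →L[ℂ] ℂ, ∀ p, e (hdense.poly p) = p.eval ζ :=
    exists_congr fun e => ⟨fun h p => h p _ (hdense.isPoly p),
      fun h p f hf => by rw [hdense.eq_poly hf, h]⟩
  rw [key]
  tfae_have 1 → 2 := fun ⟨_, he⟩ =>
    DeBrangesRovnyak.SchurClass.hasEigenvalue_of_eval_bounded hinv hdense he
  tfae_have 2 → 3 :=
    DeBrangesRovnyak.SchurClass.closedSpan_ne_univ_of_hasEigenvalue hinv hdense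
  tfae_have 3 → 1 := DeBrangesRovnyak.SchurClass.exists_eval_of_closedSpan_ne_univ hdense
  tfae_have 1 → 4 := fun ⟨e, he⟩ f =>
    ⟨e f, DeBrangesRovnyak.SchurClass.hasNontangentialLimit hdense he f⟩
  tfae_have 4 → 1 :=
    DeBrangesRovnyak.SchurClass.exists_eval_of_hasNontangentialLimit hdense hζ
  tfae_finish
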